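/- Let $N\ge 5$, $\Omega_e=\{x\in\mathbb R^N:|x|>1\}$, $\overline{\Omega_e}=\{x\in\mathbb R^N:|x|\ge 1\}$, $\sigma>-4$, $0<\mu\le\mu^*:=\left(\frac{N(N-4)}{4}\right)^2$, and set $$\mu_N=\frac{N-4}{2}+\sqrt{\left(\frac{N-2}{2}\right)^2+1-\sqrt{(N-2)^2+\mu}},\qquad p_{\mathrm{crit}}=1+\frac{\sigma+4}{\mu_N}.$$ Consider the problem $$\text{(E)}\qquad \Delta^2u-\frac{\mu}{|x|^4}u=|x|^\sigma|u|^p+f(x)\ \text{ in }\Omega_e,\qquad u=\Delta u=0\ \text{ on }\partial B_1=\{|x|=1\}.$$ A weak solution of (E) is a function $u\in L^p_{\mathrm{loc}}(\overline{\Omega_e})$ such that $$\int_{\Omega_e}|x|^\sigma|u|^p\varphi\,dx+\int_{\Omega_e}f\varphi\,dx=\int_{\Omega_e}u\left(\Delta^2\varphi-\frac{\mu}{|x|^4}\varphi\right)dx$$ for every nonnegative $\varphi\in C^4(\overline{\Omega_e})$ with compact support in $\overline{\Omega_e}$ and $\varphi=\Delta\varphi=0$ on $\partial B_1$. A smooth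 solution of (E) is a function $u\in C^\infty(\overline{\Omega_e})$ that satisfies the equation at every point of $\Omega_e$ and the boundary conditions at every point of $\partial B_1$. For $\eta\in\mathbb R$ let $\mathcal F^+_\eta$ (respectively $\mathcal F^-_\eta$) be the set of continuous functions $f:\overline{\Omega_e}\to(0,\infty)$ for which there is a constant $c>0$ with $f(x)\ge c|x|^{-\eta}$ (respectively $f(x)\le c|x|^{-\eta}$) for all sufficiently large $|x|$. Assume $p>p_{\mathrm{crit}}$. Then: (i) If $\eta<4+\frac{\sigma+4}{p-1}$, then for every $f\in\mathcal F^+_\eta$ problem (E) has no weak solution. (ii) If $4+\frac{\sigma+4}{p-1}\le\eta<\mu_N+4$, then there is some $f\in\mathcal F^-_\eta$ for which problem (E) has a smooth solution. -/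

import Mathlib

open MeasureTheory
open scoped ContDiff

noncomputable section

namespace HardyRellich

/-- The space `ℝ^N` with its Euclidean norm. -/
abbrev Space (N : ℕ) : Type := EuclideanSpace ℝ (Fin N)

/-- The exterior domain: the complement of the closed unit ball. -/
def exterior (N : ℕ) : Set (Space N) := {x | 1 < ‖x‖}

/-- The closure of the exterior domain: the complement of the open unit ball. -/
def closedExterior (N : ℕ) : Set (Space N) := {x | 1 ≤ ‖x‖}

/-- The best constant `(N (N - 4) / 4) ^ 2` of the Hardy–Rellich inequality. -/
def muStar (N : ℕ) : ℝ := ((N : ℝ) * ((N : ℝ) - 4) / 4) ^ 2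

/-- The exponent `μ_N`. -/
def muN (N : ℕ) (μ : ℝ) : ℝ :=
  ((N : ℝ) - 4) / 2 +
    Real.sqrt ((((N : ℝ) - 2) / 2) ^ 2 + 1 - Real.sqrt (((N : ℝ) - 2) ^ 2 + μ))

/-- The first critical exponent `1 + (σ + 4) / μ_N`. -/
def pCrit (N : ℕ) (μ σ : ℝ) : ℝ := 1 + (σ + 4) / muN N μ

/-- The operator `Δ² - μ / |x|⁴`, used at points of the (open) exterior domain. -/
def hardyRellichOp (N : ℕ) (μ : ℝ) (v : Space N → ℝ) (x : Space N) : ℝ :=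
  Laplacian.laplacian (Laplacian.laplacian v : Space N → ℝ) x - μ / ‖x‖ ^ 4 * v x

/-- Navier boundary conditions `v = Δ v = 0` on the unit sphere. The Laplacian at a boundary point
is the one-sided one, computed from the values of `v` on the closed exterior domain only. -/
def NavierBC (N : ℕ) (v : Space N → ℝ) : Prop :=
  ∀ x : Space N, ‖x‖ = 1 →
    v x = 0 ∧ InnerProductSpace.laplacianWithin v (closedExterior N) x = 0

/-- `u ∈ L^p_loc` on the closed exterior domain: `u ∈ L^p(K)` for each compact subset `K`. -/
def MemLpLocExterior (N : ℕ) (p : ℝ) (u : Space N → ℝ) : Prop :=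
  ∀ K : Set (Space N), IsCompact K → K ⊆ closedExterior N →
    MemLp u (ENNReal.ofReal p) (volume.restrict K)

/-- Admissible test functions: nonnegative, `C⁴` up to the boundary, with compact support in the
closed exterior domain (the support may meet the unit sphere), and `φ = Δ φ = 0` on the sphere.
Values of `φ` inside the open unit ball are irrelevant. -/
structure IsTestFunction (N : ℕ) (φ : Space N → ℝ) : Prop where
  contDiffOn : ContDiffOn ℝ 4 φ (closedExterior N)
  compactSupport : ∃ K : Set (Space N), IsCompact K ∧ K ⊆ closedExterior N ∧
    ∀ x ∈ closedExterior N, x ∉ K → φ x = 0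
  nonneg : ∀ x ∈ closedExterior N, 0 ≤ φ x
  navier : NavierBC N φ

/-- Weak solutions of
`Δ² u - μ |x|⁻⁴ u = |x|^σ |u|^p + f` in the exterior domain, `u = Δ u = 0` on the unit sphere. -/
structure IsWeakSolution (N : ℕ) (μ σ p : ℝ) (f u : Space N → ℝ) : Prop where
  memLpLoc : MemLpLocExterior N p u
  weak : ∀ φ : Space N → ℝ, IsTestFunction N φ →
    (∫ x in exterior N, ‖x‖ ^ σ * |u x| ^ p * φ x) + (∫ x in exterior N, f x * φ x) =
      ∫ x in exterior N, u x * hardyRellichOp N μ φ x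

/-- Solutions of the same problem that are `C^∞` up to the boundary: the equation holds at every
point of the exterior domain, the boundary conditions at every point of the unit sphere. -/
structure IsSmoothSolution (N : ℕ) (μ σ p : ℝ) (f u : Space N → ℝ) : Prop where
  contDiffOn : ContDiffOn ℝ ∞ u (closedExterior N)
  equation : ∀ x ∈ exterior N, hardyRellichOp N μ u x = ‖x‖ ^ σ * |u x| ^ p + f x
  navier : NavierBC N u

/-- The class `F⁺_η`: continuous positive functions on the closed exterior domain that are bounded
below by a positive multiple of `|x|^(-η)` for large `|x|`. -/
def FPlus (N : ℕ) (η : ℝ) : Set (Space N → ℝ) :=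
  {f | ContinuousOn f (closedExterior N) ∧ (∀ x ∈ closedExterior N, 0 < f x) ∧
    ∃ c : ℝ, 0 < c ∧ ∃ R : ℝ, ∀ x ∈ closedExterior N, R ≤ ‖x‖ → c * ‖x‖ ^ (-η) ≤ f x}

/-- The class `F⁻_η`: continuous positive functions on the closed exterior domain that are bounded
above by a positive multiple of `|x|^(-η)` for large `|x|`. -/
def FMinus (N : ℕ) (η : ℝ) : Set (Space N → ℝ) :=
  {f | ContinuousOn f (closedExterior N) ∧ (∀ x ∈ closedExterior N, 0 < f x) ∧
    ∃ c : ℝ, 0 < c ∧ ∃ R : ℝ, ∀ x ∈ closedExterior N, R ≤ ‖x‖ → f x ≤ c * ‖x‖ ^ (-η)}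

end HardyRellich

end

noncomputable section

namespace HardyRellich

open Laplacian InnerProductSpace Filter Topology

/-! (i) is a scaling argument. Test with `Φ (x / R)`, where `Φ` is a bump supported in an annulus
away from the unit sphere. Young's inequality absorbs `u * (Δ² - μ / |x|⁴) φ` into `|x|^σ |u|^p φ`,
so the nonlinear term cancels and the average of `f` at scale `R` is `O(R ^ (-(4p+σ)/(p-1)))`
(`IsWeakSolution.lower_bound_le`). Since `(4p+σ)/(p-1) = 4 + (σ+4)/(p-1)`, a slower decay rate `η`
is contradicted as `R → ∞`.

(ii) is an explicit construction. The operator multiplies `|x|^(-r)` by a quartic in `r` and lowers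
the exponent by 4. The quartic vanishes at `muN` and at a larger root `m` and is negative in
between. Hence `v = A|x|^(-muN) - |x|^(-κ) + C|x|^(-m)`, with `muN < κ < m`, is sent to a positive
multiple of `|x|^(-κ-4)`, while `A` and `C` fit the two boundary conditions (`exists_profile`).
Supercriticality allows `κ` so close to `muN` that `|x|^σ |v|^p` decays at least as fast as
`|x|^(-κ-4)`. For small `ε`, `u = ε v` then leaves a positive remainder, which is taken as `f`. -/

/-! ### Laplacians up to the boundary and in coordinates. -/

theorem uniqueDiffOn_closedExterior (N : ℕ) : UniqueDiffOn ℝ (closedExterior N) := by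
  intro x hx
  have hx1 : (1 : ℝ) ≤ ‖x‖ := hx
  have hx0 : ‖x‖ ≠ 0 := by positivity
  -- Tangent ball condition: this ball lies outside the unit ball and has `x` on its boundary.
  have hsub : Metric.ball ((2 : ℝ) • x) ‖x‖ ⊆ closedExterior N := by
    intro y hy
    rw [Metric.mem_ball, dist_eq_norm] at hy
    have h1 : ‖(2 : ℝ) • x‖ ≤ ‖y‖ + ‖y - (2 : ℝ) • x‖ := by
      have := norm_sub_le y (y - (2 : ℝ) • x)
      rwa [sub_sub_cancel] at this
    rw [norm_smul, Real.norm_ofNat] at h1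
    show (1 : ℝ) ≤ ‖y‖
    linarith
  refine UniqueDiffWithinAt.mono ?_ hsub
  refine uniqueDiffWithinAt_convex (convex_ball _ _) ?_ ?_
  · rw [Metric.isOpen_ball.interior_eq]
    exact Metric.nonempty_ball.2 (by positivity)
  · rw [closure_ball _ hx0, Metric.mem_closedBall, dist_eq_norm, two_smul]
    simp

theorem laplacianWithin_closedExterior_eq {N : ℕ} {v : Space N → ℝ} {x : Space N}
    (hv : ContDiffAt ℝ 2 v x) (hx : x ∈ closedExterior N) :
    laplacianWithin v (closedExterior N) x = laplacian v x := by
  have hU := uniqueDiffOn_closedExterior N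
  rw [laplacianWithin_eq_iteratedFDerivWithin_stdOrthonormalBasis v hU hx,
    laplacian_eq_iteratedFDeriv_stdOrthonormalBasis,
    iteratedFDerivWithin_eq_iteratedFDeriv hU (by exact_mod_cast hv) hx]

theorem laplacian_eq_sum_fderiv {N : ℕ} {v : Space N → ℝ} {x : Space N}
    (hv : ContDiffAt ℝ 2 v x) :
    laplacian v x = ∑ i, fderiv ℝ (fun y => fderiv ℝ v y (EuclideanSpace.basisFun (Fin N) ℝ i)) x
      (EuclideanSpace.basisFun (Fin N) ℝ i) := by
  rw [laplacian_eq_iteratedFDeriv_orthonormalBasis v (EuclideanSpace.basisFun (Fin N) ℝ)]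
  refine Finset.sum_congr rfl fun i _ => ?_
  have h1 : DifferentiableAt ℝ (fderiv ℝ v) x :=
    (hv.fderiv_right (m := 1) (by norm_num)).differentiableAt (by norm_num)
  rw [iteratedFDeriv_two_apply, fderiv_clm_apply h1 (by fun_prop)]
  simp

/-! ### The operator on radial powers. -/

theorem contDiffAt_norm_rpow {N : ℕ} {n : ℕ∞} (a : ℝ) {x : Space N} (hx : x ≠ 0) :
    ContDiffAt ℝ n (fun y : Space N => ‖y‖ ^ a) x :=
  (contDiffAt_norm ℝ hx).rpow_const_of_ne (norm_ne_zero_iff.2 hx)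

theorem hasFDerivAt_norm_rpow_of_ne {N : ℕ} (a : ℝ) {x : Space N} (hx : x ≠ 0) :
    HasFDerivAt (fun y : Space N => ‖y‖ ^ a) ((a * ‖x‖ ^ (a - 2)) • innerSL ℝ x) x := by
  have h0 : 0 < ‖x‖ := norm_pos_iff.2 hx
  have h := (hasStrictFDerivAt_norm_sq x).hasFDerivAt.rpow_const (p := a / 2)
    (Or.inl (by positivity))
  have e : (fun y : Space N => (‖y‖ ^ 2) ^ (a / 2)) = fun y => ‖y‖ ^ a := by
    funext y
    rw [← Real.rpow_natCast, ← Real.rpow_mul (norm_nonneg y)]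
    congr 1
    push_cast
    ring
  rw [e] at h
  have e2 : (‖x‖ ^ 2) ^ (a / 2 - 1) = ‖x‖ ^ (a - 2) := by
    rw [← Real.rpow_natCast, ← Real.rpow_mul h0.le]
    congr 1
    push_cast
    ring
  have e3 : (a / 2 * (‖x‖ ^ 2) ^ (a / 2 - 1)) • 2 • innerSL ℝ x =
      (a * ‖x‖ ^ (a - 2)) • innerSL ℝ x := by
    rw [e2]
    ext y
    simp
    ring
  exact e3 ▸ h

theorem laplacian_norm_rpow {N : ℕ} (a : ℝ) {x : Space N} (hx : x ≠ 0) :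
    laplacian (fun y : Space N => ‖y‖ ^ a) x = a * (a + N - 2) * ‖x‖ ^ (a - 2) := by
  have h0 : 0 < ‖x‖ := norm_pos_iff.2 hx
  rw [laplacian_eq_sum_fderiv (contDiffAt_norm_rpow (n := 2) a hx)]
  have hterm : ∀ i : Fin N,
      fderiv ℝ (fun y => fderiv ℝ (fun y : Space N => ‖y‖ ^ a) y
        (EuclideanSpace.basisFun (Fin N) ℝ i)) x (EuclideanSpace.basisFun (Fin N) ℝ i) =
      a * (a - 2) * ‖x‖ ^ (a - 2 - 2) * (x i) ^ 2 + a * ‖x‖ ^ (a - 2) := by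
    intro i
    have hev : (fun y => fderiv ℝ (fun y : Space N => ‖y‖ ^ a) y
        (EuclideanSpace.basisFun (Fin N) ℝ i)) =ᶠ[𝓝 x]
        fun y => a * ‖y‖ ^ (a - 2) * y i := by
      filter_upwards [isOpen_ne.mem_nhds hx] with y hy
      rw [(hasFDerivAt_norm_rpow_of_ne a hy).fderiv]
      simp [EuclideanSpace.inner_single_right]
    have hd : HasFDerivAt (fun y : Space N => a * ‖y‖ ^ (a - 2) * y i)
        ((a * ‖x‖ ^ (a - 2)) • (EuclideanSpace.proj i : Space N →L[ℝ] ℝ) +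
          (x i) • (a • (((a - 2) * ‖x‖ ^ (a - 2 - 2)) • innerSL ℝ x))) x := by
      exact ((hasFDerivAt_norm_rpow_of_ne (a - 2) hx).const_mul a).mul
        (EuclideanSpace.proj i : Space N →L[ℝ] ℝ).hasFDerivAt
    rw [hev.fderiv_eq, hd.fderiv]
    simp [EuclideanSpace.inner_single_right]
    ring
  simp_rw [hterm]
  rw [Finset.sum_add_distrib, ← Finset.mul_sum, ← EuclideanSpace.real_norm_sq_eq]
  have e : ‖x‖ ^ (a - 2 - 2) * ‖x‖ ^ 2 = ‖x‖ ^ (a - 2) := by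
    rw [← Real.rpow_natCast, ← Real.rpow_add h0]
    congr 1
    push_cast
    ring
  rw [mul_assoc, e]
  simp
  ring

/-- A linear combination of three radial powers. -/
def powerSum (N : ℕ) (A B C a b c : ℝ) (x : Space N) : ℝ :=
  A * ‖x‖ ^ a + B * ‖x‖ ^ b + C * ‖x‖ ^ c

theorem contDiffAt_powerSum {N : ℕ} {n : ℕ∞} (A B C a b c : ℝ) {x : Space N} (hx : x ≠ 0) :
    ContDiffAt ℝ n (powerSum N A B C a b c) x :=
  ((contDiffAt_const.mul (contDiffAt_norm_rpow a hx)).add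
    (contDiffAt_const.mul (contDiffAt_norm_rpow b hx))).add
    (contDiffAt_const.mul (contDiffAt_norm_rpow c hx))

theorem laplacian_powerSum {N : ℕ} (A B C a b c : ℝ) {x : Space N} (hx : x ≠ 0) :
    laplacian (powerSum N A B C a b c) x =
      powerSum N (a * (a + N - 2) * A) (b * (b + N - 2) * B) (c * (c + N - 2) * C)
        (a - 2) (b - 2) (c - 2) x := by
  have h (a : ℝ) : ContDiffAt ℝ 2 (fun y : Space N => ‖y‖ ^ a) x :=
    contDiffAt_norm_rpow (n := 2) a hx
  have h' (A a : ℝ) : ContDiffAt ℝ 2 (A • fun y : Space N => ‖y‖ ^ a) x :=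
    contDiffAt_const.smul (h a)
  have e : powerSum N A B C a b c = (A • fun y : Space N => ‖y‖ ^ a) +
      (B • fun y : Space N => ‖y‖ ^ b) + (C • fun y : Space N => ‖y‖ ^ c) := rfl
  have hAB : ContDiffAt ℝ 2 ((A • fun y : Space N => ‖y‖ ^ a) + (B • fun y : Space N => ‖y‖ ^ b))
      x := (h' A a).add (h' B b)
  rw [e, hAB.laplacian_add (h' C c), (h' A a).laplacian_add (h' B b),
    laplacian_smul _ (h a), laplacian_smul _ (h b), laplacian_smul _ (h c),
    laplacian_norm_rpow a hx, laplacian_norm_rpow b hx, laplacian_norm_rpow c hx]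
  simp only [smul_eq_mul, powerSum]
  ring

/-- The symbol of `Δ² - μ |x|⁻⁴` on radial powers: the operator maps `|x| ^ a` to
`symbol N μ a * |x| ^ (a - 4)`. -/
def symbol (N : ℕ) (μ a : ℝ) : ℝ :=
  a * (a + N - 2) * ((a - 2) * (a - 2 + N - 2)) - μ

theorem hardyRellichOp_powerSum {N : ℕ} (μ A B C a b c : ℝ) {x : Space N} (hx : x ≠ 0) :
    hardyRellichOp N μ (powerSum N A B C a b c) x =
      powerSum N (symbol N μ a * A) (symbol N μ b * B) (symbol N μ c * C)
        (a - 4) (b - 4) (c - 4) x := by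
  have h0 : 0 < ‖x‖ := norm_pos_iff.2 hx
  have hev : laplacian (powerSum N A B C a b c) =ᶠ[𝓝 x]
      powerSum N (a * (a + N - 2) * A) (b * (b + N - 2) * B) (c * (c + N - 2) * C)
        (a - 2) (b - 2) (c - 2) := by
    filter_upwards [isOpen_ne.mem_nhds hx] with y hy
    exact laplacian_powerSum A B C a b c hy
  have hs (a : ℝ) : ‖x‖ ^ a = ‖x‖ ^ (a - 4) * ‖x‖ ^ 4 := by
    rw [← Real.rpow_natCast, ← Real.rpow_add h0]
    congr 1
    push_cast
    ring
  rw [hardyRellichOp, (laplacian_congr_nhds hev).self_of_nhds, laplacian_powerSum _ _ _ _ _ _ hx]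
  simp only [powerSum, symbol]
  rw [hs a, hs b, hs c]
  have e (a : ℝ) : a - 2 - 2 = a - 4 := by ring
  rw [e, e, e]
  field_simp
  ring

/-! ### The supersolution profile and existence. -/

/-- Centring at `-(N-4)/2` makes the quartic even in `t`: its factors pair up to `t² - ((N-4)/2)²`
and `t² - (N/2)²`, so its roots are found by solving a quadratic in `t²`. -/
theorem symbol_neg_eq (N : ℕ) (μ t : ℝ) :
    symbol N μ (-(((N : ℝ) - 4) / 2 + t)) =
      (t ^ 2 - ((((N : ℝ) - 2) / 2) ^ 2 + 1)) ^ 2 - (((N : ℝ) - 2) ^ 2 + μ) := by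
  rw [symbol]
  ring

/-- The square of the right side minus `(N-2)²` is exactly `muStar N`. This keeps the outer root in
`muN` real. -/
theorem sqrt_le_of_le_muStar {N : ℕ} {μ : ℝ} (hμ' : μ ≤ muStar N) :
    Real.sqrt (((N : ℝ) - 2) ^ 2 + μ) ≤ (((N : ℝ) - 2) / 2) ^ 2 + 1 := by
  rw [Real.sqrt_le_left (by positivity)]
  rw [muStar] at hμ'
  nlinarith

theorem muN_pos {N : ℕ} (hN : 5 ≤ N) (μ : ℝ) : 0 < muN N μ := by
  have h : (5 : ℝ) ≤ N := by exact_mod_cast hN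
  have := Real.sqrt_nonneg ((((N : ℝ) - 2) / 2) ^ 2 + 1 - Real.sqrt (((N : ℝ) - 2) ^ 2 + μ))
  rw [muN]
  linarith

theorem one_lt_of_pCrit_lt {N : ℕ} (hN : 5 ≤ N) {σ μ p : ℝ} (hσ : -4 < σ)
    (hp : pCrit N μ σ < p) : 1 < p := by
  have := div_pos (by linarith : 0 < σ + 4) (muN_pos hN μ)
  rw [pCrit] at hp
  linarith

/-- Exponents and coefficients of a profile with Navier boundary values, built from the homogeneous
solutions `|x| ^ (-muN N μ)` and `|x| ^ (-m)` and a power `|x| ^ (-κ)` that decays slightly faster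
than the first. -/
theorem exists_profile {N : ℕ} (hN : 5 ≤ N) {μ : ℝ} (hμ : 0 < μ) (hμ' : μ ≤ muStar N)
    {d : ℝ} (hd : 0 < d) :
    ∃ κ m A C : ℝ, muN N μ < κ ∧ κ ≤ muN N μ + d ∧ muN N μ < m ∧
      symbol N μ (-muN N μ) = 0 ∧ symbol N μ (-m) = 0 ∧ symbol N μ (-κ) < 0 ∧
      A - 1 + C = 0 ∧
      -muN N μ * (-muN N μ + N - 2) * A + -κ * (-κ + N - 2) * (-1) + -m * (-m + N - 2) * C = 0 := by
  have hN5 : (5 : ℝ) ≤ N := by exact_mod_cast hN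
  set S := Real.sqrt (((N : ℝ) - 2) ^ 2 + μ) with hS
  set Q := (((N : ℝ) - 2) / 2) ^ 2 + 1 with hQ
  have hS2 : S ^ 2 = ((N : ℝ) - 2) ^ 2 + μ := Real.sq_sqrt (by positivity)
  have hSQ : S ≤ Q := sqrt_le_of_le_muStar hμ'
  have hS0 : 0 < S := Real.sqrt_pos.2 (by positivity)
  have hS2' : (N : ℝ) - 2 < S := by
    rw [hS]
    exact Real.lt_sqrt_of_sq_lt (by linarith)
  set t := Real.sqrt (Q - S) with ht
  have ht2 : t ^ 2 = Q - S := Real.sq_sqrt (by linarith)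
  have ht0 : 0 ≤ t := Real.sqrt_nonneg _
  set s := Real.sqrt (Q + S) with hs
  have hs2 : s ^ 2 = Q + S := Real.sq_sqrt (by positivity)
  have hs0 : 0 ≤ s := Real.sqrt_nonneg _
  have hts : t < s := Real.sqrt_lt_sqrt (by linarith) (by linarith)
  have hs3 : 2 < s := by
    rw [hs]
    refine Real.lt_sqrt_of_sq_lt ?_
    nlinarith
  have hmu : muN N μ = ((N : ℝ) - 4) / 2 + t := rfl
  -- `t + e` lies strictly between the two roots, also when `t = 0` is a double root.
  obtain ⟨e, he0, hed, hes⟩ : ∃ e : ℝ, 0 < e ∧ e ≤ d ∧ t + e < s := by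
    refine ⟨min d ((s - t) / 2), lt_min hd (by linarith), min_le_left _ _, ?_⟩
    have := min_le_right d ((s - t) / 2)
    linarith
  -- Up to a constant, `g r` is the factor produced by the Laplacian on `|x|^(-((N-4)/2+r))`. The
  -- constant drops out since the coefficients sum to zero, and `s > 2` makes the boundary system
  -- for `A`, `C` nonsingular.
  set g : ℝ → ℝ := fun r => r ^ 2 - 2 * r with hg
  have hg0 : g t - g s ≠ 0 := by
    have : g t - g s = (t - s) * (t + s - 2) := by simp only [hg]; ring
    rw [this]
    exact mul_ne_zero (by linarith) (by linarith)
  have hgm (r A : ℝ) : -(((N : ℝ) - 4) / 2 + r) * (-(((N : ℝ) - 4) / 2 + r) + N - 2) * A =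
      (g r - (N : ℝ) * (N - 4) / 4) * A := by
    simp only [hg]; ring
  refine ⟨((N : ℝ) - 4) / 2 + (t + e), ((N : ℝ) - 4) / 2 + s, (g (t + e) - g s) / (g t - g s),
    1 - (g (t + e) - g s) / (g t - g s), by linarith, by linarith, by linarith, ?_, ?_, ?_,
    by ring, ?_⟩
  · rw [hmu, symbol_neg_eq, ht2, ← hS2]; ring
  · rw [symbol_neg_eq, hs2, ← hS2]; ring
  · rw [symbol_neg_eq, ← hS2, ← hQ]
    have h1 : t ^ 2 < (t + e) ^ 2 := by nlinarith
    have h2 : (t + e) ^ 2 < s ^ 2 := by nlinarith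
    nlinarith
  · rw [hmu, hgm, hgm, hgm]
    field_simp
    ring

theorem exists_smoothSolution {N : ℕ} (hN : 5 ≤ N) {σ μ p η : ℝ} (hσ : -4 < σ)
    (hμ : 0 < μ) (hμ' : μ ≤ muStar N) (hp : pCrit N μ σ < p) (hη : η < muN N μ + 4) :
    ∃ f ∈ FMinus N η, ∃ u : Space N → ℝ, IsSmoothSolution N μ σ p f u := by
  have hp1 : 1 < p := one_lt_of_pCrit_lt hN hσ hp
  have hm0 : 0 < muN N μ := muN_pos hN μ
  -- This gap is the room for `κ`: `κ ≤ muN + d` says exactly `σ - muN * p ≤ -κ - 4`.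
  have hd : 0 < (p - 1) * muN N μ - (σ + 4) := by
    rw [pCrit, ← lt_sub_iff_add_lt', div_lt_iff₀ hm0] at hp
    linarith
  obtain ⟨κ, m, A, C, hκ, hκd, hm, h1, h3, h2, hbc, hbc'⟩ := exists_profile hN hμ hμ' hd
  set k := muN N μ with hk
  set K := -symbol N μ (-κ) with hK
  have hK0 : 0 < K := by linarith
  set v := powerSum N A (-1) C (-k) (-κ) (-m) with hv
  set M := |A| + 1 + |C| with hM
  have hM0 : 0 < M := by positivity
  have hne {x : Space N} (hx : x ∈ closedExterior N) : x ≠ 0 := by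
    rintro rfl
    have : (1 : ℝ) ≤ ‖(0 : Space N)‖ := hx
    rw [norm_zero] at this
    linarith
  have hvb {x : Space N} (hx : x ∈ closedExterior N) : |v x| ≤ M * ‖x‖ ^ (-k) := by
    have hx1 : (1 : ℝ) ≤ ‖x‖ := hx
    have h0 (a : ℝ) : 0 ≤ ‖x‖ ^ a := by positivity
    have ha : ‖x‖ ^ (-κ) ≤ ‖x‖ ^ (-k) := Real.rpow_le_rpow_of_exponent_le hx1 (by linarith)
    have hb : ‖x‖ ^ (-m) ≤ ‖x‖ ^ (-k) := Real.rpow_le_rpow_of_exponent_le hx1 (by linarith)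
    calc |v x| ≤ |A * ‖x‖ ^ (-k)| + |-1 * ‖x‖ ^ (-κ)| + |C * ‖x‖ ^ (-m)| := abs_add_three _ _ _
      _ = |A| * ‖x‖ ^ (-k) + ‖x‖ ^ (-κ) + |C| * ‖x‖ ^ (-m) := by
        simp [abs_mul, abs_of_nonneg (h0 _)]
      _ ≤ |A| * ‖x‖ ^ (-k) + ‖x‖ ^ (-k) + |C| * ‖x‖ ^ (-k) := by gcongr
      _ = M * ‖x‖ ^ (-k) := by rw [hM]; ring
  have hnl {x : Space N} (hx : x ∈ closedExterior N) :
      ‖x‖ ^ σ * |v x| ^ p ≤ M ^ p * ‖x‖ ^ (-κ - 4) := by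
    have hx1 : (1 : ℝ) ≤ ‖x‖ := hx
    have hx0 : 0 < ‖x‖ := by linarith
    calc ‖x‖ ^ σ * |v x| ^ p ≤ ‖x‖ ^ σ * (M * ‖x‖ ^ (-k)) ^ p := by
          gcongr
          exact hvb hx
      _ = M ^ p * ‖x‖ ^ (σ + -k * p) := by
        rw [Real.mul_rpow hM0.le (by positivity), ← Real.rpow_mul hx0.le, Real.rpow_add hx0]
        ring
      _ ≤ M ^ p * ‖x‖ ^ (-κ - 4) := by
        gcongr 1
        · exact Real.rpow_le_rpow_of_exponent_le hx1 (by linarith)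
  obtain ⟨ε, hε, hεK⟩ : ∃ ε : ℝ, 0 < ε ∧ ε ^ p * M ^ p < ε * K := by
    have hMp : 0 < M ^ p := by positivity
    -- Chosen so that `ε ^ (p - 1) * M ^ p = K / 2`.
    set b := K / (2 * M ^ p) with hb
    have hb0 : 0 < b := by positivity
    refine ⟨b ^ (1 / (p - 1)), by positivity, ?_⟩
    set ε := b ^ (1 / (p - 1)) with hε
    have hε0 : 0 < ε := by positivity
    have e1 : ε ^ (p - 1) = b := by
      rw [hε, ← Real.rpow_mul hb0.le, one_div_mul_cancel (by linarith), Real.rpow_one]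
    have e2 : ε ^ p = ε * b := by
      rw [← e1, ← Real.rpow_one_add' hε0.le (by linarith)]
      congr 1
      ring
    have e3 : b * M ^ p = K / 2 := by rw [hb]; field_simp
    rw [e2, mul_assoc, e3]
    exact mul_lt_mul_of_pos_left (by linarith) hε0
  set u : Space N → ℝ := powerSum N (ε * A) (ε * -1) (ε * C) (-k) (-κ) (-m) with hu
  have huv (x : Space N) : u x = ε * v x := by simp only [hu, hv, powerSum]; ring
  have hucd {x : Space N} (hx : x ∈ closedExterior N) : ContDiffAt ℝ ∞ u x :=
    contDiffAt_powerSum _ _ _ _ _ _ (hne hx)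
  have hcd : ContDiffOn ℝ ∞ u (closedExterior N) := fun x hx => (hucd hx).contDiffWithinAt
  set f : Space N → ℝ := fun x => ε * K * ‖x‖ ^ (-κ - 4) - ‖x‖ ^ σ * |u x| ^ p with hf
  have hup (x : Space N) : |u x| ^ p = ε ^ p * |v x| ^ p := by
    rw [huv, abs_mul, abs_of_pos hε, Real.mul_rpow hε.le (abs_nonneg _)]
  have hrc (a : ℝ) : ContinuousOn (fun x : Space N => ‖x‖ ^ a) (closedExterior N) :=
    continuous_norm.continuousOn.rpow_const fun x hx => Or.inl (norm_ne_zero_iff.2 (hne hx))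
  refine ⟨f, ⟨?_, ?_, ε * K, by positivity, 1, ?_⟩, u, hcd, ?_, ?_⟩
  · exact (continuousOn_const.mul (hrc _)).sub ((hrc _).mul
      (hcd.continuousOn.abs.rpow_const fun x _ => Or.inr (by linarith)))
  · intro x hx
    have hx1 : (1 : ℝ) ≤ ‖x‖ := hx
    have hr : 0 < ‖x‖ ^ (-κ - 4) := by positivity
    simp only [hf]
    rw [hup, sub_pos]
    calc ‖x‖ ^ σ * (ε ^ p * |v x| ^ p) = ε ^ p * (‖x‖ ^ σ * |v x| ^ p) := by ring
      _ ≤ ε ^ p * (M ^ p * ‖x‖ ^ (-κ - 4)) := by gcongr 1; exact hnl hx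
      _ = (ε ^ p * M ^ p) * ‖x‖ ^ (-κ - 4) := by ring
      _ < ε * K * ‖x‖ ^ (-κ - 4) := by gcongr
  · intro x hx _
    have hx1 : (1 : ℝ) ≤ ‖x‖ := hx
    have hnn : 0 ≤ ‖x‖ ^ σ * |u x| ^ p := by positivity
    have hle : ‖x‖ ^ (-κ - 4) ≤ ‖x‖ ^ (-η) :=
      Real.rpow_le_rpow_of_exponent_le hx1 (by linarith)
    calc f x ≤ ε * K * ‖x‖ ^ (-κ - 4) := by simp only [hf]; linarith
      _ ≤ ε * K * ‖x‖ ^ (-η) := by gcongr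
  · intro x hx
    have hx' : x ∈ closedExterior N := le_of_lt (show 1 < ‖x‖ from hx)
    rw [hu, hardyRellichOp_powerSum _ _ _ _ _ _ _ (hne hx'), ← hu, h1, h3]
    simp only [hf, powerSum, hK]
    ring
  · intro x hx
    have hx' : x ∈ closedExterior N := hx.ge
    refine ⟨?_, ?_⟩
    · rw [huv, hv, powerSum, hx]
      simp only [Real.one_rpow, mul_one]
      rw [← sub_eq_add_neg, hbc, mul_zero]
    · rw [laplacianWithin_closedExterior_eq ((hucd hx').of_le (by norm_cast)) hx', hu,
        laplacian_powerSum _ _ _ _ _ _ (hne hx'), powerSum, hx]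
      simp only [Real.one_rpow, mul_one]
      linear_combination ε * hbc'

/-! ### Cutoff functions and scaling. -/

theorem fderiv_pow_succ_mul {N : ℕ} {χ g : Space N → ℝ} (hχ : ContDiff ℝ ∞ χ)
    (hg : ContDiff ℝ ∞ g) (m : ℕ) (w : Space N) :
    ∃ h : Space N → ℝ, ContDiff ℝ ∞ h ∧
      ∀ x, fderiv ℝ (fun y => χ y ^ (m + 1) * g y) x w = χ x ^ m * h x := by
  have hdir {k : Space N → ℝ} (hk : ContDiff ℝ ∞ k) : ContDiff ℝ ∞ fun x => fderiv ℝ k x w :=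
    (hk.fderiv_right (m := ∞) (by norm_cast)).clm_apply contDiff_const
  refine ⟨fun x => (m + 1) * fderiv ℝ χ x w * g x + χ x * fderiv ℝ g x w,
    ((contDiff_const.mul (hdir hχ)).mul hg).add (hχ.mul (hdir hg)), fun x => ?_⟩
  have h1 : DifferentiableAt ℝ χ x := hχ.differentiable (by simp) x
  have h2 : DifferentiableAt ℝ g x := hg.differentiable (by simp) x
  have h3 : HasFDerivAt (fun y => χ y ^ (m + 1) * g y) _ x :=
    (h1.hasFDerivAt.pow (m + 1)).mul h2.hasFDerivAt
  rw [h3.fderiv]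
  simp
  ring

/-- Each derivative costs one power of `χ`. Applied twice, it shows that the bilaplacian of `χ ^ (m
+ 4)` keeps the factor `χ ^ m`. -/
theorem laplacian_pow_mul {N : ℕ} {χ g : Space N → ℝ} (hχ : ContDiff ℝ ∞ χ)
    (hg : ContDiff ℝ ∞ g) (m : ℕ) :
    ∃ h : Space N → ℝ, ContDiff ℝ ∞ h ∧
      laplacian (fun y => χ y ^ (m + 2) * g y) = fun x => χ x ^ m * h x := by
  choose h1 hh1 e1 using fun w => fderiv_pow_succ_mul hχ hg (m + 1) w
  choose h2 hh2 e2 using fun w => fderiv_pow_succ_mul hχ (hh1 w) m w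
  refine ⟨fun x => ∑ i, h2 (EuclideanSpace.basisFun (Fin N) ℝ i) x,
    ContDiff.sum fun i _ => hh2 _, ?_⟩
  funext x
  have hcd : ContDiff ℝ 2 fun y => χ y ^ (m + 2) * g y :=
    ((hχ.pow _).mul hg).of_le (by norm_cast)
  rw [laplacian_eq_sum_fderiv hcd.contDiffAt, Finset.mul_sum]
  refine Finset.sum_congr rfl fun i _ => ?_
  rw [← e2]
  congr 2
  funext y
  exact e1 _ y

theorem contDiff_laplacian {N : ℕ} {g : Space N → ℝ} (hg : ContDiff ℝ ∞ g) :
    ContDiff ℝ ∞ (laplacian g : Space N → ℝ) := by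
  obtain ⟨h, hh, e⟩ := laplacian_pow_mul (χ := fun _ : Space N => (1 : ℝ)) contDiff_const hg 0
  simp only [one_pow, one_mul] at e
  rwa [e]

theorem laplacian_comp_const_smul {N : ℕ} {g : Space N → ℝ} (hg : ContDiff ℝ ∞ g) (a : ℝ) :
    (laplacian fun y => g (a • y)) = fun x => a ^ 2 * laplacian g (a • x) := by
  have hg2 : ContDiff ℝ (2 : ℕ) g := hg.of_le (by norm_cast)
  funext x
  rw [laplacian_eq_iteratedFDeriv_stdOrthonormalBasis,
    laplacian_eq_iteratedFDeriv_stdOrthonormalBasis, iteratedFDeriv_comp_const_smul a hg2]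
  simp [Finset.mul_sum]

theorem bilaplacian_comp_const_smul {N : ℕ} {g : Space N → ℝ} (hg : ContDiff ℝ ∞ g) (a : ℝ)
    (x : Space N) :
    laplacian (laplacian (fun y => g (a • y)) : Space N → ℝ) x =
      a ^ 4 * laplacian (laplacian g : Space N → ℝ) (a • x) := by
  have hL := contDiff_laplacian hg
  have hcomp : ContDiff ℝ 2 fun y : Space N => laplacian g (a • y) :=
    (hL.comp (contDiff_const_smul a)).of_le (by norm_cast)
  have e : (fun y : Space N => a ^ 2 * laplacian g (a • y)) =
      (a ^ 2) • fun y : Space N => laplacian g (a • y) := rfl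
  rw [laplacian_comp_const_smul hg, e, laplacian_smul _ hcomp.contDiffAt,
    laplacian_comp_const_smul hL, smul_eq_mul]
  ring

/-- A cutoff function whose bilaplacian is controlled by a power of the function itself. -/
theorem exists_cutoff {N : ℕ} (y : Space N) {p : ℝ} (hp : 1 < p) :
    ∃ Φ : Space N → ℝ, ContDiff ℝ ∞ Φ ∧ (∀ x, 0 ≤ Φ x) ∧ (∀ x, Φ x ≤ 1) ∧
      (∀ x ∈ Metric.closedBall y 1, Φ x = 1) ∧ (∀ x, x ∉ Metric.closedBall y 2 → Φ x = 0) ∧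
      ∃ C : ℝ, 0 ≤ C ∧
        ∀ x, |laplacian (laplacian Φ : Space N → ℝ) x| ≤ C * Φ x ^ (1 / p) := by
  let χ : ContDiffBump y := ⟨1, 2, one_pos, one_lt_two⟩
  have hχ : ContDiff ℝ ∞ χ := χ.contDiff
  -- Equivalent to `(m + 4) / p ≤ m`, which gives `χ ^ m ≤ (χ ^ (m + 4)) ^ (1 / p)` because `0 ≤ χ ≤
  -- 1`.
  obtain ⟨m, hm⟩ := exists_nat_ge (4 / (p - 1))
  have hp0 : 0 < p - 1 := by linarith
  have hm0 : m ≠ 0 := by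
    rintro rfl
    have : 0 < 4 / (p - 1) := by positivity
    rw [Nat.cast_zero] at hm
    linarith
  obtain ⟨h1, hh1, e1⟩ :=
    laplacian_pow_mul hχ (contDiff_const (c := (1 : ℝ))) (m + 2)
  obtain ⟨h2, hh2, e2⟩ := laplacian_pow_mul hχ hh1 m
  simp only [mul_one] at e1
  obtain ⟨C, hC⟩ :=
    (isCompact_closedBall y 2).exists_bound_of_continuousOn hh2.continuous.continuousOn
  have h01 (x : Space N) : 0 ≤ χ x := χ.nonneg
  have hoff (x : Space N) (hx : x ∉ Metric.closedBall y 2) : χ x = 0 := by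
    refine χ.zero_of_le_dist ?_
    rw [Metric.mem_closedBall, not_le] at hx
    exact hx.le
  refine ⟨fun x => χ x ^ (m + 2 + 2), hχ.pow _, fun x => pow_nonneg (h01 x) _,
    fun x => pow_le_one₀ (h01 x) χ.le_one, fun x hx => ?_, fun x hx => ?_, |C|, abs_nonneg _,
    fun x => ?_⟩
  · have : χ x = 1 := χ.one_of_mem_closedBall hx
    simp only [this, one_pow]
  · simp only [hoff x hx]
    exact zero_pow (by omega)
  · rw [e1, e2]
    by_cases hx : x ∈ Metric.closedBall y 2
    · have hle : χ x ^ m ≤ (χ x ^ (m + 2 + 2)) ^ (1 / p) := by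
        rcases (h01 x).eq_or_lt with h | h
        · rw [← h, zero_pow hm0]
          positivity
        · rw [← Real.rpow_natCast, ← Real.rpow_natCast, ← Real.rpow_mul h.le]
          refine Real.rpow_le_rpow_of_exponent_ge h χ.le_one ?_
          rw [mul_one_div, div_le_iff₀ (by linarith)]
          rw [div_le_iff₀ hp0] at hm
          push_cast
          linarith
      rw [abs_mul, abs_of_nonneg (pow_nonneg (h01 x) m), mul_comm]
      have := hC x hx
      rw [Real.norm_eq_abs] at this
      exact mul_le_mul (this.trans (le_abs_self C)) hle (pow_nonneg (h01 x) m) (abs_nonneg _)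
    · simp only [hoff x hx]
      rw [zero_pow hm0, zero_mul, abs_zero]
      positivity

/-! ### The rescaled test function estimate and nonexistence. -/

theorem rpow_le_of_comparable {R r : ℝ} (hR : 0 < R) (h1 : R ≤ r) (h2 : r ≤ 6 * R) (a : ℝ) :
    r ^ a ≤ 6 ^ |a| * R ^ a := by
  have hq1 : 1 ≤ r / R := (one_le_div hR).2 h1
  have hq2 : r / R ≤ 6 := (div_le_iff₀ hR).2 h2
  calc r ^ a = (r / R) ^ a * R ^ a := by
        rw [← Real.mul_rpow (by positivity) hR.le, div_mul_cancel₀ _ hR.ne']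
    _ ≤ 6 ^ |a| * R ^ a := by
        gcongr
        calc (r / R) ^ a ≤ (r / R) ^ |a| :=
              Real.rpow_le_rpow_of_exponent_le hq1 (le_abs_self a)
          _ ≤ 6 ^ |a| := by gcongr

/-- The weight `r ^ (σ / p) * φ ^ (1 / p)` is split off so that the `p`-th power reproduces the
nonlinear term with coefficient at most one, ready to cancel. -/
theorem young_weighted {p σ w t r φ D : ℝ} (hp : 1 < p) (hr : 0 < r) (hφ : 0 ≤ φ) (hD : 0 ≤ D)
    (hw : |w| ≤ D * φ ^ (1 / p)) :
    t * w ≤ r ^ σ * |t| ^ p * φ + (D * r ^ (-(σ / p))) ^ (p / (p - 1)) := by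
  have hp0 : 0 < p := by linarith
  have hpq : p.HolderConjugate (p / (p - 1)) := Real.HolderConjugate.conjExponent hp
  set X := r ^ (σ / p) * |t| * φ ^ (1 / p) with hX
  set Y := D * r ^ (-(σ / p)) with hY
  have hX0 : 0 ≤ X := by positivity
  have hY0 : 0 ≤ Y := by positivity
  have hXp : X ^ p = r ^ σ * |t| ^ p * φ := by
    rw [hX, Real.mul_rpow (by positivity) (by positivity),
      Real.mul_rpow (by positivity) (by positivity), ← Real.rpow_mul hr.le, ← Real.rpow_mul hφ,
      div_mul_cancel₀ _ hp0.ne', div_mul_cancel₀ _ hp0.ne', Real.rpow_one]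
  have hXY : X * Y = |t| * (D * φ ^ (1 / p)) := by
    have : r ^ (σ / p) * r ^ (-(σ / p)) = 1 := by
      rw [← Real.rpow_add hr, add_neg_cancel, Real.rpow_zero]
    rw [hX, hY]
    linear_combination |t| * φ ^ (1 / p) * D * this
  have hle (z s : ℝ) (hz : 0 ≤ z) (hs : 1 < s) : z ^ s / s ≤ z ^ s :=
    div_le_self (by positivity) hs.le
  calc t * w ≤ |t| * |w| := by rw [← abs_mul]; exact le_abs_self _
    _ ≤ |t| * (D * φ ^ (1 / p)) := by gcongr
    _ = X * Y := hXY.symm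
    _ ≤ X ^ p / p + Y ^ (p / (p - 1)) / (p / (p - 1)) :=
      Real.young_inequality_of_nonneg hX0 hY0 hpq
    _ ≤ X ^ p + Y ^ (p / (p - 1)) :=
      add_le_add (hle _ _ hX0 hp) (hle _ _ hY0 hpq.symm.lt)
    _ = _ := by rw [hXp]

/-- The rescaled integral inequality: a weak solution forces the average of `f` over a ball of
radius `R` at distance `4 R` to be at most of order `R ^ (-(4 p + σ) / (p - 1))`. -/
theorem IsWeakSolution.lower_bound_le {N : ℕ} (hN : 5 ≤ N) {σ μ p : ℝ} (hμ : 0 < μ) (hp : 1 < p)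
    {f u : Space N → ℝ} (hfc : ContinuousOn f (closedExterior N))
    (hf0 : ∀ x ∈ closedExterior N, 0 < f x) (hu : IsWeakSolution N μ σ p f u) :
    ∃ C : ℝ, ∀ R b : ℝ, 1 ≤ R → (∀ x : Space N, R ≤ ‖x‖ → ‖x‖ ≤ 6 * R → b ≤ f x) →
      b ≤ C * R ^ (-((4 * p + σ) / (p - 1))) := by
  have hp0 : 0 < p := by linarith
  have hp1 : 0 < p - 1 := by linarith
  -- Distance 4 and support radius 2 place the rescaled support in `2R ≤ |x| ≤ 6R`, off the unit
  -- sphere since `R ≥ 1`. The boundary conditions are then trivial.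
  set y : Space N := EuclideanSpace.single ⟨0, by omega⟩ 4 with hy
  have hyn : ‖y‖ = 4 := by simp [hy]
  obtain ⟨Φ, hΦ, hΦ0, hΦ1, hΦin, hΦout, C, hC0, hC⟩ := exists_cutoff y hp
  set q := p / (p - 1) with hq
  have hq0 : 0 < q := by positivity
  set D := (C + μ) * 6 ^ |-(σ / p)| with hDdef
  have hD0 : 0 ≤ D := by positivity
  -- `2 ^ N` is the volume ratio of the support ball `K` to the ball `K'` where `φ = 1`.
  refine ⟨D ^ q * 2 ^ N, fun R b hR hb => ?_⟩
  have hR0 : 0 < R := by linarith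
  have hRi : R⁻¹ * R = 1 := inv_mul_cancel₀ hR0.ne'
  set φ : Space N → ℝ := fun x => Φ (R⁻¹ • x) with hφ
  set K := Metric.closedBall (R • y) (2 * R) with hK
  set K' := Metric.closedBall (R • y) R with hK'
  have hKc : IsCompact K := isCompact_closedBall _ _
  have hdist (x : Space N) : dist (R⁻¹ • x) y = R⁻¹ * dist x (R • y) := by
    rw [dist_eq_norm, dist_eq_norm, ← abs_of_pos (inv_pos.2 hR0), ← Real.norm_eq_abs, ← norm_smul,
      Real.norm_eq_abs, abs_of_pos (inv_pos.2 hR0), smul_sub, smul_smul, hRi, one_smul]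
  have hRy : ‖R • y‖ = 4 * R := by
    rw [norm_smul, hyn, Real.norm_eq_abs, abs_of_pos hR0, mul_comm]
  have hKn {x : Space N} (hx : x ∈ K) : 2 * R ≤ ‖x‖ ∧ ‖x‖ ≤ 6 * R := by
    rw [hK, Metric.mem_closedBall, dist_eq_norm] at hx
    have h1 := norm_sub_norm_le x (R • y)
    have h2 := norm_sub_norm_le (R • y) x
    rw [norm_sub_rev] at h2
    constructor <;> linarith
  have hKext : K ⊆ exterior N := fun x hx => by
    have := (hKn hx).1
    show 1 < ‖x‖
    linarith
  have hKcl : K ⊆ closedExterior N := fun x hx => (show 1 < ‖x‖ from hKext hx).le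
  have hK'K : K' ⊆ K := Metric.closedBall_subset_closedBall (by linarith)
  have hφ0 (x : Space N) : 0 ≤ φ x := hΦ0 _
  have hφK {x : Space N} (hx : x ∉ K) : φ x = 0 := by
    refine hΦout _ fun h => hx ?_
    rw [Metric.mem_closedBall, hdist, inv_mul_le_iff₀ hR0] at h
    rw [hK, Metric.mem_closedBall]
    linarith
  have hφK' {x : Space N} (hx : x ∈ K') : φ x = 1 := by
    refine hΦin _ ?_
    rw [Metric.mem_closedBall, hdist, inv_mul_le_iff₀ hR0, mul_one]
    exact hx
  have hφcd : ContDiff ℝ ∞ φ := hΦ.comp (contDiff_const_smul _)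
  have hφt : IsTestFunction N φ := by
    refine ⟨(hφcd.of_le (by norm_cast)).contDiffOn, ⟨K, hKc, hKcl, fun x _ hx => hφK hx⟩,
      fun x _ => hφ0 x, fun x hx => ?_⟩
    have hxK : x ∉ K := fun h => by
      have := (hKn h).1
      linarith
    refine ⟨hφK hxK, ?_⟩
    have hev : φ =ᶠ[𝓝 x] fun _ => 0 := by
      filter_upwards [hKc.isClosed.isOpen_compl.mem_nhds hxK] with z hz
      exact hφK hz
    rw [laplacianWithin_closedExterior_eq (hφcd.of_le (by norm_cast)).contDiffAt hx.ge,
      (laplacian_congr_nhds hev).self_of_nhds, laplacian_const]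
    rfl
  have hφp (x : Space N) : φ x ≤ φ x ^ (1 / p) := by
    have h := Real.rpow_le_rpow_of_exponent_ge' (hφ0 x) (hΦ1 (R⁻¹ • x)) (by positivity)
      ((div_le_one hp0).2 hp.le)
    rwa [Real.rpow_one] at h
  have hop {x : Space N} (hx : x ∈ exterior N) (hx' : x ∉ K ∨ R ≤ ‖x‖) :
      |hardyRellichOp N μ φ x| ≤ (C + μ) * R⁻¹ ^ 4 * φ x ^ (1 / p) := by
    have hx1 : 1 < ‖x‖ := hx
    have h1 : |laplacian (laplacian φ : Space N → ℝ) x| ≤ C * R⁻¹ ^ 4 * φ x ^ (1 / p) := by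
      rw [hφ, bilaplacian_comp_const_smul hΦ, abs_mul, abs_of_nonneg (by positivity)]
      calc _ ≤ R⁻¹ ^ 4 * (C * Φ (R⁻¹ • x) ^ (1 / p)) := by gcongr; exact hC _
        _ = _ := by ring
    have h2 : |μ / ‖x‖ ^ 4 * φ x| ≤ μ * R⁻¹ ^ 4 * φ x ^ (1 / p) := by
      rcases hx' with h | h
      · rw [hφK h, mul_zero, abs_zero]
        positivity
      · rw [abs_of_nonneg (mul_nonneg (by positivity) (hφ0 x)), inv_pow, ← div_eq_mul_inv]
        gcongr
        · exact hφ0 x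
        · exact hφp x
    calc |hardyRellichOp N μ φ x| ≤ _ := abs_sub _ _
      _ ≤ C * R⁻¹ ^ 4 * φ x ^ (1 / p) + μ * R⁻¹ ^ 4 * φ x ^ (1 / p) := add_le_add h1 h2
      _ = _ := by ring
  have hopK {x : Space N} (hx : x ∈ exterior N) (hxK : x ∉ K) : hardyRellichOp N μ φ x = 0 := by
    have h := hop hx (Or.inl hxK)
    rw [hφK hxK, Real.zero_rpow (by positivity), mul_zero] at h
    exact abs_eq_zero.1 (le_antisymm h (abs_nonneg _))
  set B := D ^ q * R ^ (-((4 * p + σ) / (p - 1))) with hB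
  have hpt {x : Space N} (hx : x ∈ K) :
      u x * hardyRellichOp N μ φ x ≤ ‖x‖ ^ σ * |u x| ^ p * φ x + B := by
    obtain ⟨hx1, hx2⟩ := hKn hx
    have hRx : R ≤ ‖x‖ := by linarith
    have h := young_weighted (σ := σ) (t := u x) hp (by linarith : 0 < ‖x‖) (hφ0 x)
      (by positivity) (hop (hKext hx) (Or.inr hRx))
    refine h.trans (add_le_add le_rfl ?_)
    calc ((C + μ) * R⁻¹ ^ 4 * ‖x‖ ^ (-(σ / p))) ^ (p / (p - 1))
        ≤ ((C + μ) * R⁻¹ ^ 4 * (6 ^ |-(σ / p)| * R ^ (-(σ / p)))) ^ q := by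
          gcongr
          exact rpow_le_of_comparable hR0 hRx hx2 _
      _ = (D * R ^ (-4 + -(σ / p))) ^ q := by
          rw [Real.rpow_add hR0, hDdef, Real.rpow_neg hR0.le 4, inv_pow,
            ← Real.rpow_natCast R 4]
          push_cast
          ring_nf
      _ = B := by
          rw [Real.mul_rpow hD0 (by positivity), ← Real.rpow_mul hR0.le, hB, hq]
          congr 2
          field_simp
          ring
  have hfK : IntegrableOn (fun x => f x * φ x) K :=
    ((hfc.mono hKcl).mul hφcd.continuous.continuousOn).integrableOn_compact hKc
  have hKfin : IsFiniteMeasure (volume.restrict K) := ⟨by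
    rw [Measure.restrict_apply_univ]; exact hKc.measure_lt_top⟩
  have hup := hu.memLpLoc K hKc hKcl
  have hnormc : ContinuousOn (fun x : Space N => ‖x‖ ^ σ) K :=
    continuous_norm.continuousOn.rpow_const fun x hx => Or.inl (by linarith [(hKn hx).1])
  have hpK : IntegrableOn (fun x => ‖x‖ ^ σ * |u x| ^ p * φ x) K := by
    have h1 : IntegrableOn (fun x => |u x| ^ p) K := by
      have := hup.integrable_norm_rpow (by simpa using hp0) ENNReal.ofReal_ne_top
      simp only [ENNReal.toReal_ofReal hp0.le, Real.norm_eq_abs] at this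
      exact this
    have h2 := h1.mul_continuousOn (hnormc.mul hφcd.continuous.continuousOn) hKc
    refine h2.congr_fun (fun x _ => ?_) hKc.measurableSet
    show |u x| ^ p * (‖x‖ ^ σ * φ x) = _
    ring
  have hopc : ContinuousOn (hardyRellichOp N μ φ) K := by
    have h1 : Continuous (laplacian (laplacian φ : Space N → ℝ) : Space N → ℝ) :=
      (contDiff_laplacian (contDiff_laplacian hφcd)).continuous
    refine h1.continuousOn.sub (ContinuousOn.mul ?_ hφcd.continuous.continuousOn)
    refine continuousOn_const.div (continuous_norm.pow 4).continuousOn fun x hx => ?_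
    have := (hKn hx).1
    have : 0 < ‖x‖ := by linarith
    positivity
  have huK : IntegrableOn (fun x => u x * hardyRellichOp N μ φ x) K := by
    have h1 : IntegrableOn u K := hup.integrable (by
      rw [← ENNReal.ofReal_one]; exact ENNReal.ofReal_le_ofReal hp.le)
    exact h1.mul_continuousOn hopc hKc
  have hextm : MeasurableSet (exterior N) :=
    (isOpen_lt continuous_const continuous_norm).measurableSet
  have hred (g : Space N → ℝ) (hg : ∀ x ∈ exterior N, x ∉ K → g x = 0) :
      ∫ x in exterior N, g x = ∫ x in K, g x :=
    setIntegral_eq_of_subset_of_forall_sdiff_eq_zero hextm hKext fun x hx => hg x hx.1 hx.2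
  have hw := hu.weak φ hφt
  rw [hred _ fun x _ hx => by rw [hφK hx, mul_zero], hred _ fun x _ hx => by rw [hφK hx, mul_zero],
    hred _ fun x hx hxK => by rw [hopK hx hxK, mul_zero]] at hw
  have hBint : IntegrableOn (fun _ : Space N => B) K := integrableOn_const hKc.measure_lt_top.ne
  -- The nonlinear integral, finite by `hpK`, cancels against the one in the weak formulation.
  have hupper : ∫ x in K, f x * φ x ≤ volume.real K * B := by
    have h1 : ∫ x in K, u x * hardyRellichOp N μ φ x ≤
        ∫ x in K, (‖x‖ ^ σ * |u x| ^ p * φ x + B) :=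
      setIntegral_mono_on huK (hpK.add hBint) hKc.measurableSet fun x hx => hpt hx
    rw [integral_add hpK hBint, setIntegral_const, smul_eq_mul] at h1
    linarith
  have hlower : volume.real K' * b ≤ ∫ x in K, f x * φ x := by
    calc volume.real K' * b = ∫ _ in K', b := by rw [setIntegral_const, smul_eq_mul]
      _ ≤ ∫ x in K', f x * φ x := by
        refine setIntegral_mono_on (integrableOn_const (measure_mono hK'K |>.trans_lt
          hKc.measure_lt_top).ne) (hfK.mono_set hK'K) Metric.isClosed_closedBall.measurableSet
          fun x hx => ?_
        obtain ⟨h1, h2⟩ := hKn (hK'K hx)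
        rw [hφK' hx, mul_one]
        exact hb x (by linarith) h2
      _ ≤ ∫ x in K, f x * φ x := by
        refine setIntegral_mono_set hfK ?_ hK'K.eventuallyLE
        filter_upwards [ae_restrict_mem hKc.measurableSet] with x hx
        exact mul_nonneg (hf0 x (hKcl hx)).le (hφ0 x)
  have hvol : volume.real K = 2 ^ N * volume.real K' := by
    have hfr : Module.finrank ℝ (Space N) = N := by simp
    rw [hK, hK', Measure.addHaar_real_closedBall _ _ (by positivity),
      Measure.addHaar_real_closedBall _ _ hR0.le, hfr]
    ring
  have hvol0 : 0 < volume.real K' :=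
    ENNReal.toReal_pos (Metric.measure_closedBall_pos volume _ hR0).ne'
      (measure_mono hK'K |>.trans_lt hKc.measure_lt_top).ne
  have hfin : volume.real K' * b ≤ volume.real K' * (2 ^ N * B) := by
    calc _ ≤ volume.real K * B := hlower.trans hupper
      _ = _ := by rw [hvol]; ring
  have := le_of_mul_le_mul_left hfin hvol0
  calc b ≤ 2 ^ N * B := this
    _ = _ := by rw [hB]; ring

theorem not_exists_weakSolution {N : ℕ} (hN : 5 ≤ N) {σ μ p η : ℝ} (hμ : 0 < μ) (hp : 1 < p)
    (hη : η < 4 + (σ + 4) / (p - 1)) {f : Space N → ℝ} (hf : f ∈ FPlus N η) :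
    ¬ ∃ u : Space N → ℝ, IsWeakSolution N μ σ p f u := by
  rintro ⟨u, hu⟩
  obtain ⟨hfc, hf0, c, hc, R₀, hfR⟩ := hf
  obtain ⟨C, hC⟩ := hu.lower_bound_le hN hμ hp hfc hf0
  have hp1 : 0 < p - 1 := by linarith
  set δ := (4 * p + σ) / (p - 1) - η with hδ
  have hδ0 : 0 < δ := by
    have : (4 * p + σ) / (p - 1) = 4 + (σ + 4) / (p - 1) := by field_simp; ring
    rw [hδ, this]
    linarith
  have h6 : (0 : ℝ) < 6 ^ |η| := by positivity
  have hbd : ∀ R : ℝ, max 1 R₀ ≤ R → R ^ δ ≤ C * 6 ^ |η| / c := by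
    intro R hR
    have hR1 : 1 ≤ R := (le_max_left _ _).trans hR
    have hR0 : 0 < R := by linarith
    -- The lower bound `c |x| ^ (-η)` made uniform on the annulus `R ≤ |x| ≤ 6R`.
    have h := hC R (c * (6 ^ |η| * R ^ η)⁻¹) hR1 fun x hx1 hx2 => by
      have hx0 : 0 < ‖x‖ := by linarith
      refine le_trans ?_ (hfR x (hR1.trans hx1) (((le_max_right _ _).trans hR).trans hx1))
      rw [Real.rpow_neg hx0.le]
      gcongr
      exact rpow_le_of_comparable hR0 hx1 hx2 η
    have hs : R ^ (-((4 * p + σ) / (p - 1))) = (R ^ δ * R ^ η)⁻¹ := by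
      rw [← Real.rpow_add hR0, ← Real.rpow_neg hR0.le, hδ, sub_add_cancel]
    rw [hs] at h
    have hRη : 0 < R ^ η := by positivity
    have hRδ : 0 < R ^ δ := by positivity
    rw [le_div_iff₀ hc]
    have h' := mul_le_mul_of_nonneg_right h (by positivity : 0 ≤ 6 ^ |η| * R ^ η * R ^ δ)
    have e1 : c * (6 ^ |η| * R ^ η)⁻¹ * (6 ^ |η| * R ^ η * R ^ δ) = R ^ δ * c := by
      field_simp
    have e2 : C * (R ^ δ * R ^ η)⁻¹ * (6 ^ |η| * R ^ η * R ^ δ) = C * 6 ^ |η| := by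
      field_simp
    rwa [e1, e2] at h'
  obtain ⟨R, hR, hR'⟩ := (((tendsto_rpow_atTop hδ0).eventually_gt_atTop (C * 6 ^ |η| / c)).and
    (eventually_ge_atTop (max 1 R₀))).exists
  exact absurd (hbd R hR') (not_le.2 hR)

end HardyRellich

end

theorem mainTheorem4 (N : ℕ) (hN : 5 ≤ N) (σ μ p : ℝ) (hσ : -4 < σ)
    (hμ : 0 < μ) (hμ' : μ ≤ HardyRellich.muStar N) (hp : HardyRellich.pCrit N μ σ < p) :
    (∀ η : ℝ, η < 4 + (σ + 4) / (p - 1) →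
      ∀ f ∈ HardyRellich.FPlus N η,
        ¬ ∃ u : HardyRellich.Space N → ℝ, HardyRellich.IsWeakSolution N μ σ p f u) ∧
    (∀ η : ℝ, 4 + (σ + 4) / (p - 1) ≤ η → η < HardyRellich.muN N μ + 4 →
      ∃ f ∈ HardyRellich.FMinus N η,
        ∃ u : HardyRellich.Space N → ℝ, HardyRellich.IsSmoothSolution N μ σ p f u) :=
  ⟨fun _ hη _ hf => HardyRellich.not_exists_weakSolution hN hμ
    (HardyRellich.one_lt_of_pCrit_lt hN hσ hp) hη hf,
  fun _ _ hη => HardyRellich.exists_smoothSolution hN hσ hμ hμ' hp hη⟩
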